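/- Let $\mathcal B\subseteq\mathbb N=\{1,2,\dots\}$ be a non-empty set which is primitive, i.e. there are no two distinct $b,b'\in\mathcal B$ with $b\mid b'$. For $\mathcal C\subseteq\mathbb N$ put $\mathcal M_{\mathcal C}:=\bigcup_{c\in\mathcal C}c\mathbb Z$, and let $$\boldsymbol\delta(\mathcal M_{\mathcal C}):=\lim_{n\to\infty}\frac1{\log n}\sum_{1\le k\le n,\ k\in\mathcal M_{\mathcal C}}\frac1k$$ be its logarithmic density (the limit exists by the Davenport–Erdős theorem). The set $\mathcal B$ is called taut if $\boldsymbol\delta(\mathcal M_{\mathcal B\setminus\{b\}})<\boldsymbol\delta(\mathcal M_{\mathcal B})$ for every $b\in\mathcal B$. Let $\Delta:\mathbb Z\to\prod_{b\in\mathcal B}\mathbb Z/b\mathbb Z$, $\Delta(n)=(n \bmod b)_{b\in\mathcal B}$, where the product carries the product of the discrete topologies. Let $H:=\overline{\Delta(\mathbb Z)}$, a compact abelian group, let $m_H$ be its normalised Haar measure, and let $W:=\{h\in H: h_b\neq0\text{ for all }b\in\mathcal B\}$ be the window. Then the following are equivalent: (i) $\mathcal B$ is taut. (ii) $W$ is Haar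 regular, i.e. $\operatorname{supp}(m_H|_W)=W$. Moreover, each of these two properties implies (iii) $\overline{\Delta(\mathbb Z)\cap W}=W$. -/

import Mathlib

open MeasureTheory Filter Topology

namespace BFree

/-- `ℬ ⊆ {1, 2, …}` is primitive: no element of `ℬ` divides another (different) one. -/
def Primitive (B : Set ℕ+) : Prop :=
  ∀ b ∈ B, ∀ b' ∈ B, (b : ℕ) ∣ (b' : ℕ) → b = b'

/-- The set of multiples `⋃_{b ∈ ℬ} b ℤ`. -/
def multiples (B : Set ℕ+) : Set ℤ :=
  {n : ℤ | ∃ b ∈ B, (b : ℤ) ∣ n}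

open scoped Classical in
/-- The logarithmic density of `A ⊆ ℤ` exists and equals `d`, i.e.
`(1 / log n) ∑_{1 ≤ k ≤ n, k ∈ A} 1 / k → d` as `n → ∞`. -/
def HasLogDensity (A : Set ℤ) (d : ℝ) : Prop :=
  Tendsto (fun n : ℕ =>
    (1 / Real.log n) * ∑ k ∈ (Finset.Icc 1 n).filter (fun k : ℕ => (k : ℤ) ∈ A), (1 / (k : ℝ)))
    atTop (𝓝 d)

/-- `ℬ` is taut: removing any single element strictly decreases the logarithmic density of the
set of multiples. -/
def Taut (B : Set ℕ+) : Prop :=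
  ∀ b ∈ B, ∃ d d' : ℝ, HasLogDensity (multiples (B \ {b})) d ∧
    HasLogDensity (multiples B) d' ∧ d < d'

/-- The compact group `∏_{b ∈ ℬ} ℤ/bℤ`, with the product of the discrete topologies. -/
abbrev ProdGroup (B : Set ℕ+) : Type :=
  (b : B) → ZMod ((b : ℕ+) : ℕ)

/-- The diagonal homomorphism `ℤ → ∏_{b ∈ ℬ} ℤ/bℤ`, `n ↦ (n, n, …)`. -/
def diagProd (B : Set ℕ+) : ℤ →+ ProdGroup B where
  toFun n := fun _ => (n : ZMod _)
  map_zero' := by ext; simp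
  map_add' m n := by ext; simp

/-- `H`, the closure of the image of the diagonal homomorphism. -/
def H (B : Set ℕ+) : AddSubgroup (ProdGroup B) :=
  (diagProd B).range.topologicalClosure

instance compactSpace_H (B : Set ℕ+) : CompactSpace (H B) :=
  isCompact_iff_compactSpace.mp
    ((AddSubgroup.isClosed_topologicalClosure (diagProd B).range).isCompact)

/-- The diagonal map `Δ`, with values in `H`. -/
def diag (B : Set ℕ+) (n : ℤ) : H B :=
  ⟨diagProd B n, AddSubgroup.le_topologicalClosure _ ⟨n, rfl⟩⟩

/-- Haar measure on `H`, normalised to have total mass `1`. -/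
noncomputable def haarH (B : Set ℕ+) : Measure (H B) :=
  Measure.addHaarMeasure (⊤ : TopologicalSpace.PositiveCompacts (H B))

/-- The window `W = {h ∈ H : h_b ≠ 0 for all b ∈ ℬ}`. -/
def window (B : Set ℕ+) : Set (H B) :=
  {h | ∀ b : B, (h : ProdGroup B) b ≠ 0}

/-- The window is Haar regular: the (topological) support of the restriction of Haar measure
to the window is the whole window. -/
def HaarRegular (B : Set ℕ+) : Prop :=
  ((haarH B).restrict (window B)).support = window B

end BFree

/-! Both properties are equivalent to one arithmetic condition: `B` contains no dilate `g A` of a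
Behrend set, meaning a set `A` with `1 ∉ A` whose multiples have logarithmic density one, i.e. `free
A` is null.

The analytic input is a correlation inequality: two functions of `gcd (N, n)` that decrease under
divisibility are positively correlated over the residues mod `N`. Applied to two indicators of free
sets it gives Behrend's inequality, so if `B ∪ C` is Behrend then one of `B`, `C` is. Applied to the
indicator of `{d ≤ x}` and that of a free set, it bounds logarithmic sums from below and yields
Davenport–Erdős: the density of `free B` is the limit of the densities for truncations.

If `g A ⊆ B` and `a ∈ A`, then `A \ {a}` is still Behrend by Behrend's inequality, so almost all
multiples of `g`, in particular of `a g`, are covered without `a g`, and `B` is not taut.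
Conversely, let `n + l ℤ` be almost covered by multiples of `B` although no `b ∈ B` divides both `n`
and `l`. Division by `g = gcd (n, l)` leaves a progression `r + q ℤ` with `r` coprime to `q`, on
which only the quotients `b / gcd (b, g)` coprime to `q` matter. By the Chinese remainder theorem
these cover almost all integers, and Behrend's inequality isolates a single value `g'` of `gcd (b,
g)` whose quotients form a Behrend set (`exists_dilate_of_null`).

On the dynamical side, a cylinder of `H` corresponds to a progression, and truncations turn Haar
measure into density: the cylinder meets the window in measure zero exactly when the progression
meets `free B` in a null set. Haar regularity thus says that no progression attached to a cylinder
around a point of the window is almost covered, which is compared with tautness through the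
criterion above. Property (iii) follows because a set that is not null is not empty. -/

namespace BFree

/-! ### Correlation inequality for functions antitone under divisibility -/

/-- Sum of `f (gcd (N, n))` over the residues `n` mod `N`, grouped by the value of the gcd. -/
noncomputable def gcdSum (N : ℕ) (f : ℕ → ℝ) : ℝ :=
  ∑ d ∈ N.divisors, (Nat.totient (N / d) : ℝ) * f d

/-- `f` is antitone for divisibility of positive integers. -/
def DvdAntitone (f : ℕ → ℝ) : Prop :=
  ∀ d e : ℕ, d ∣ e → 0 < e → f e ≤ f d

lemma gcdSum_eq_sum_range (N : ℕ) (hN : 0 < N) (f : ℕ → ℝ) :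
    gcdSum N f = ∑ n ∈ Finset.range N, f (N.gcd n) := by
  have hmaps : ∀ n ∈ Finset.range N, N.gcd n ∈ N.divisors := fun n _ =>
    Nat.mem_divisors.2 ⟨Nat.gcd_dvd_left _ _, hN.ne'⟩
  rw [← Finset.sum_fiberwise_of_maps_to hmaps, gcdSum]
  refine Finset.sum_congr rfl fun d hd => ?_
  rw [Nat.totient_div_of_dvd (Nat.dvd_of_mem_divisors hd), ← nsmul_eq_mul, ← Finset.sum_const]
  refine Finset.sum_congr rfl fun n hn => ?_
  rw [(Finset.mem_filter.1 hn).2]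

lemma gcdSum_one (N : ℕ) : gcdSum N (fun _ => 1) = N := by
  simp only [gcdSum, mul_one]
  rw [← Nat.cast_sum, Nat.sum_div_divisors N Nat.totient, Nat.sum_totient]

lemma gcdSum_mul_of_coprime {a b : ℕ} (h : a.Coprime b) (f : ℕ → ℝ) :
    gcdSum (a * b) f = gcdSum a fun d => gcdSum b fun e => f (d * e) := by
  have hinj : Set.InjOn (fun x : ℕ × ℕ => x.1 * x.2) ↑(a.divisors ×ˢ b.divisors) := by
    simpa using h.mul_injOn_divisors
  have himg : (a * b).divisors = (a.divisors ×ˢ b.divisors).image fun x => x.1 * x.2 := by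
    rw [Nat.divisors_mul]; rfl
  simp only [gcdSum]
  rw [himg, Finset.sum_image hinj, Finset.sum_product]
  refine Finset.sum_congr rfl fun d hd => ?_
  rw [Finset.mul_sum]
  refine Finset.sum_congr rfl fun e he => ?_
  have hd' := Nat.dvd_of_mem_divisors hd
  have he' := Nat.dvd_of_mem_divisors he
  rw [Nat.mul_div_mul_comm hd' he', Nat.totient_mul
    (Nat.Coprime.coprime_dvd_left (Nat.div_dvd_of_dvd hd')
      (Nat.Coprime.coprime_dvd_right (Nat.div_dvd_of_dvd he') h))]
  push_cast
  ring

lemma gcdSum_mono {N : ℕ} {f g : ℕ → ℝ} (h : ∀ d ∈ N.divisors, f d ≤ g d) :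
    gcdSum N f ≤ gcdSum N g :=
  Finset.sum_le_sum fun d hd => mul_le_mul_of_nonneg_left (h d hd) (Nat.cast_nonneg _)

lemma gcdSum_const_mul (N : ℕ) (c : ℝ) (f : ℕ → ℝ) :
    gcdSum N (fun d => c * f d) = c * gcdSum N f := by
  simp only [gcdSum, Finset.mul_sum]
  exact Finset.sum_congr rfl fun d _ => by ring

/-- Chebyshev's sum inequality, with weights. -/
lemma sum_mul_sum_le_of_pairwise {ι : Type*} (s : Finset ι) (w f g : ι → ℝ)
    (hw : ∀ i ∈ s, 0 ≤ w i) (h : ∀ i ∈ s, ∀ j ∈ s, 0 ≤ (f i - f j) * (g i - g j)) :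
    (∑ i ∈ s, w i * f i) * (∑ i ∈ s, w i * g i) ≤
      (∑ i ∈ s, w i) * ∑ i ∈ s, w i * (f i * g i) := by
  have h0 : 0 ≤ ∑ i ∈ s, ∑ j ∈ s, w i * w j * ((f i - f j) * (g i - g j)) :=
    Finset.sum_nonneg fun i hi => Finset.sum_nonneg fun j hj =>
      mul_nonneg (mul_nonneg (hw i hi) (hw j hj)) (h i hi j hj)
  have h1 : ∑ i ∈ s, ∑ j ∈ s, w i * w j * ((f i - f j) * (g i - g j)) =
      (∑ i ∈ s, w i * (f i * g i)) * (∑ j ∈ s, w j) + (∑ i ∈ s, w i) * (∑ j ∈ s, w j * (f j * g j))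
      - (∑ i ∈ s, w i * f i) * (∑ j ∈ s, w j * g j)
      - (∑ i ∈ s, w i * g i) * (∑ j ∈ s, w j * f j) := by
    simp only [Finset.sum_mul_sum, ← Finset.sum_add_distrib, ← Finset.sum_sub_distrib]
    exact Finset.sum_congr rfl fun i _ => Finset.sum_congr rfl fun j _ => by ring
  rw [h1] at h0
  nlinarith [h0]

/-- The divisors of a prime power form a chain, so there the two functions are similarly ordered and
Chebyshev's inequality applies. The property then tensorises over coprime factors: averaging out one
factor preserves antitonicity in the other. -/
lemma gcdSum_mul_gcdSum_le (N : ℕ) : ∀ f g : ℕ → ℝ, DvdAntitone f → DvdAntitone g →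
    gcdSum N f * gcdSum N g ≤ N * gcdSum N fun d => f d * g d := by
  induction N using Nat.recOnPosPrimePosCoprime with
  | prime_pow p n hp hn =>
    intro f g hf hg
    rw [← gcdSum_one (p ^ n)]
    simp only [gcdSum, mul_one]
    refine sum_mul_sum_le_of_pairwise _ _ f g (fun _ _ => Nat.cast_nonneg _) fun i hi j hj => ?_
    have hpos : ∀ i ∈ (p ^ n).divisors, 0 < i := fun i hi => Nat.pos_of_mem_divisors hi
    have hij : i ∣ j ∨ j ∣ i := by
      obtain ⟨k, _, rfl⟩ := (Nat.mem_divisors_prime_pow hp n).1 hi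
      obtain ⟨l, _, rfl⟩ := (Nat.mem_divisors_prime_pow hp n).1 hj
      exact (le_total k l).imp (pow_dvd_pow p) (pow_dvd_pow p)
    rcases hij with hij | hij
    · exact mul_nonneg (sub_nonneg.2 (hf _ _ hij (hpos j hj)))
        (sub_nonneg.2 (hg _ _ hij (hpos j hj)))
    · exact mul_nonneg_of_nonpos_of_nonpos (sub_nonpos.2 (hf _ _ hij (hpos i hi)))
        (sub_nonpos.2 (hg _ _ hij (hpos i hi)))
  | zero => intro f g _ _; simp [gcdSum]
  | one => intro f g _ _; simp [gcdSum]
  | coprime a b ha hb hab iha ihb =>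
    intro f g hf hg
    have hint : ∀ {f : ℕ → ℝ}, DvdAntitone f → DvdAntitone fun d => gcdSum b fun e => f (d * e) :=
      fun hf d d' h hd => gcdSum_mono fun e he =>
        hf _ _ (Nat.mul_dvd_mul_right h e) (Nat.mul_pos hd (Nat.pos_of_mem_divisors he))
    simp only [gcdSum_mul_of_coprime hab]
    refine (iha _ _ (hint hf) (hint hg)).trans ?_
    rw [Nat.cast_mul, mul_assoc, ← gcdSum_const_mul a (b : ℝ)]
    refine mul_le_mul_of_nonneg_left (gcdSum_mono fun d hd => ?_) (Nat.cast_nonneg _)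
    have hd0 := Nat.pos_of_mem_divisors hd
    have hanti : ∀ {f : ℕ → ℝ}, DvdAntitone f → DvdAntitone fun e => f (d * e) :=
      fun hf e e' h he => hf _ _ (Nat.mul_dvd_mul_left d h) (Nat.mul_pos hd0 he)
    exact ihb _ _ (hanti hf) (hanti hg)

/-! ### Sets closed under divisors -/

open scoped Classical in
/-- The indicator function of a set of integers, on `ℕ`. -/
noncomputable def ind (A : Set ℤ) (n : ℕ) : ℝ := if (n : ℤ) ∈ A then 1 else 0

open scoped Classical in
/-- Number of elements of `A` in `{0, …, N - 1}`. -/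
noncomputable def count (A : Set ℤ) (N : ℕ) : ℕ :=
  ((Finset.range N).filter fun k : ℕ => (k : ℤ) ∈ A).card

lemma count_eq_sum (A : Set ℤ) (N : ℕ) : (count A N : ℝ) = ∑ n ∈ Finset.range N, ind A n := by
  classical
  simp [count, ind, Finset.sum_boole]

/-- Integers that are not divisible by any element of `B`. -/
def free (B : Set ℕ+) : Set ℤ := (multiples B)ᶜ

lemma mem_free {B : Set ℕ+} {n : ℤ} : n ∈ free B ↔ ∀ b ∈ B, ¬ (b : ℤ) ∣ n := by
  simp [free, multiples]

lemma free_anti {B C : Set ℕ+} (h : B ⊆ C) : free C ⊆ free B :=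
  fun _ hn => mem_free.2 fun b hb => mem_free.1 hn b (h hb)

lemma free_union (B C : Set ℕ+) : free (B ∪ C) = free B ∩ free C := by
  ext n
  simp only [mem_free, Set.mem_inter_iff, Set.mem_union]
  exact ⟨fun h => ⟨fun b hb => h b (.inl hb), fun b hb => h b (.inr hb)⟩,
    fun h b hb => hb.elim (h.1 b) (h.2 b)⟩

lemma ind_inter (A C : Set ℤ) (n : ℕ) : ind (A ∩ C) n = ind A n * ind C n := by
  by_cases h : (n : ℤ) ∈ A <;> by_cases h' : (n : ℤ) ∈ C <;> simp [ind, h, h']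

lemma dvdAntitone_ind_free (B : Set ℕ+) : DvdAntitone (ind (free B)) := by
  intro d e hde _
  by_cases h : (e : ℤ) ∈ free B
  · have : (d : ℤ) ∈ free B := mem_free.2 fun b hb hbd =>
      mem_free.1 h b hb (hbd.trans (Int.natCast_dvd_natCast.2 hde))
    simp [ind, h, this]
  · simp only [ind, h, if_false]; split_ifs <;> norm_num

lemma gcd_mem_free {B : Set ℕ+} {N : ℕ} (hN : ∀ b ∈ B, (b : ℕ) ∣ N) (n : ℕ) :
    ((N.gcd n : ℕ) : ℤ) ∈ free B ↔ (n : ℤ) ∈ free B := by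
  simp only [mem_free]
  refine forall₂_congr fun b hb => not_congr ?_
  rw [Int.natCast_dvd_natCast, Int.natCast_dvd_natCast, Nat.dvd_gcd_iff]
  exact and_iff_right (hN b hb)

lemma gcdSum_ind_free {B : Set ℕ+} {N : ℕ} (h0 : 0 < N) (hN : ∀ b ∈ B, (b : ℕ) ∣ N) :
    gcdSum N (ind (free B)) = count (free B) N := by
  rw [gcdSum_eq_sum_range N h0, count_eq_sum]
  refine Finset.sum_congr rfl fun n _ => ?_
  classical
  exact if_congr (gcd_mem_free hN n) rfl rfl

lemma count_free_mul_count_free_le {B C : Set ℕ+} {N : ℕ} (h0 : 0 < N)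
    (hB : ∀ b ∈ B, (b : ℕ) ∣ N) (hC : ∀ b ∈ C, (b : ℕ) ∣ N) :
    (count (free B) N : ℝ) * count (free C) N ≤ N * count (free (B ∪ C)) N := by
  have h := gcdSum_mul_gcdSum_le N _ _ (dvdAntitone_ind_free B) (dvdAntitone_ind_free C)
  simp only [← ind_inter, ← free_union] at h
  rwa [gcdSum_ind_free h0 hB, gcdSum_ind_free h0 hC,
    gcdSum_ind_free h0 fun b hb => hb.elim (hB b) (hC b)] at h

open scoped Classical in
/-- The sum of `1 / k` over `1 ≤ k ≤ n`, `k ∈ A`. -/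
noncomputable def logSum (A : Set ℤ) (n : ℕ) : ℝ :=
  ∑ k ∈ (Finset.Icc 1 n).filter (fun k : ℕ => (k : ℤ) ∈ A), (1 / (k : ℝ))

lemma logSum_eq (A : Set ℤ) (n : ℕ) : logSum A n = ∑ k ∈ Finset.Icc 1 n, 1 / (k : ℝ) * ind A k := by
  classical
  rw [logSum, Finset.sum_filter]
  exact Finset.sum_congr rfl fun k _ => by simp [ind]

/-- Since `Q` divides `Q ^ 2 / k`, dividing by `k` removes no prime factor, and the totient simply
scales by `1 / k`. This is how gcd sums modulo `Q ^ 2` produce logarithmic weights. -/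
lemma totient_sq_div {Q k : ℕ} (hQ : 0 < Q) (hk : k ∣ Q) :
    (Nat.totient (Q ^ 2 / k) : ℝ) = Nat.totient (Q ^ 2) * (1 / (k : ℝ)) := by
  have hk0 : 0 < k := Nat.pos_of_dvd_of_pos hk hQ
  have hdvd : k ∣ Q ^ 2 / k := by
    rw [pow_two, Nat.mul_div_assoc _ hk]
    exact hk.mul_right _
  have h := Nat.totient_gcd_mul_totient_mul k (Q ^ 2 / k)
  rw [Nat.gcd_eq_left hdvd, Nat.mul_div_cancel' (hk.trans (dvd_pow_self Q two_ne_zero)),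
    mul_assoc] at h
  have h' := Nat.eq_of_mul_eq_mul_left (Nat.totient_pos.2 hk0) h
  rw [h']
  have : (k : ℝ) ≠ 0 := by positivity
  push_cast
  field_simp

/-- The key inequality: the logarithmic sum of a `B`-free set over an initial segment is at least
what its density predicts. -/
lemma count_free_mul_logSum_univ_le {B : Set ℕ+} {Q x : ℕ} (hQ : 0 < Q)
    (hB : ∀ b ∈ B, (b : ℕ) ∣ Q) (hx : ∀ k ∈ Finset.Icc 1 x, k ∣ Q) :
    (count (free B) (Q ^ 2) : ℝ) * logSum Set.univ x ≤ (Q ^ 2 : ℕ) * logSum (free B) x := by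
  classical
  have hdvd : Q ∣ Q ^ 2 := dvd_pow_self Q two_ne_zero
  have hQ2 : 0 < Q ^ 2 := by positivity
  -- The correlation inequality is used with the indicator of `{d ≤ x}`, a set closed under
  -- divisors.
  have hf : DvdAntitone fun d => if d ≤ x then (1 : ℝ) else 0 := by
    intro d e hde he
    by_cases h : e ≤ x
    · simp [h, (Nat.le_of_dvd he hde).trans h]
    · simp only [h, if_false]; split_ifs <;> norm_num
  have key : ∀ A : Set ℤ, gcdSum (Q ^ 2) (fun d => (if d ≤ x then (1 : ℝ) else 0) * ind A d) =
      Nat.totient (Q ^ 2) * logSum A x := by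
    intro A
    have hset : (Q ^ 2).divisors.filter (fun d => d ≤ x) = Finset.Icc 1 x := by
      ext d
      simp only [Finset.mem_filter, Nat.mem_divisors, Finset.mem_Icc]
      constructor
      · rintro ⟨⟨h1, h2⟩, h3⟩
        exact ⟨Nat.pos_of_dvd_of_pos h1 hQ2, h3⟩
      · intro h
        exact ⟨⟨(hx d (Finset.mem_Icc.2 h)).trans hdvd, hQ2.ne'⟩, h.2⟩
    rw [logSum_eq, Finset.mul_sum, ← hset, Finset.sum_filter, gcdSum]
    refine Finset.sum_congr rfl fun d hd => ?_
    by_cases h : d ≤ x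
    · have hd1 : d ∈ Finset.Icc 1 x :=
        Finset.mem_Icc.2 ⟨Nat.pos_of_mem_divisors hd, h⟩
      simp only [h, if_true, one_mul]
      rw [totient_sq_div hQ (hx d hd1), mul_assoc]
    · simp [h]
  have h := gcdSum_mul_gcdSum_le (Q ^ 2) _ _ hf (dvdAntitone_ind_free B)
  have hu := key Set.univ
  simp only [ind, Set.mem_univ, if_true, mul_one] at hu
  rw [key, hu, gcdSum_ind_free hQ2 fun b hb => (hB b hb).trans hdvd] at h
  have hφ : (0 : ℝ) < Nat.totient (Q ^ 2) := by exact_mod_cast Nat.totient_pos.2 hQ2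
  refine le_of_mul_le_mul_left ?_ hφ
  linarith

/-! ### Logarithmic density -/

lemma hasLogDensity_iff {A : Set ℤ} {d : ℝ} :
    HasLogDensity A d ↔ Tendsto (fun n : ℕ => logSum A n / Real.log n) atTop (𝓝 d) := by
  rw [HasLogDensity]
  simp only [logSum, div_eq_inv_mul, mul_one]

lemma ind_nonneg (A : Set ℤ) (n : ℕ) : 0 ≤ ind A n := by
  rw [ind]; split_ifs <;> norm_num

lemma logSum_nonneg (A : Set ℤ) (n : ℕ) : 0 ≤ logSum A n := by
  rw [logSum_eq]
  exact Finset.sum_nonneg fun k _ => mul_nonneg (by positivity) (ind_nonneg A k)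

lemma logSum_mono {A C : Set ℤ} (h : A ⊆ C) (n : ℕ) : logSum A n ≤ logSum C n := by
  classical
  refine Finset.sum_le_sum_of_subset_of_nonneg ?_ fun k _ _ => by positivity
  exact Finset.monotone_filter_right _ fun k _ hk => h hk

lemma logSum_diff {A C : Set ℤ} (h : C ⊆ A) (n : ℕ) : logSum (A \ C) n = logSum A n - logSum C n := by
  rw [logSum_eq, logSum_eq, logSum_eq, ← Finset.sum_sub_distrib]
  refine Finset.sum_congr rfl fun k _ => ?_
  by_cases hk : (k : ℤ) ∈ C
  · simp [ind, hk, h hk]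
  · by_cases hA : (k : ℤ) ∈ A
    · rw [ind, ind, ind, if_pos ⟨hA, hk⟩, if_pos hA, if_neg hk, mul_zero, sub_zero]
    · rw [ind, ind, ind, if_neg fun h => hA h.1, if_neg hA, if_neg hk, mul_zero, sub_zero]

lemma logSum_union_le (A C : Set ℤ) (n : ℕ) : logSum (A ∪ C) n ≤ logSum A n + logSum C n := by
  rw [logSum_eq, logSum_eq, logSum_eq, ← Finset.sum_add_distrib]
  refine Finset.sum_le_sum fun k _ => ?_
  rw [← mul_add]
  refine mul_le_mul_of_nonneg_left ?_ (by positivity)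
  by_cases h : (k : ℤ) ∈ A <;> by_cases h' : (k : ℤ) ∈ C <;> simp [ind, h, h']

lemma tendsto_log_natCast : Tendsto (fun n : ℕ => Real.log n) atTop atTop :=
  Real.tendsto_log_atTop.comp tendsto_natCast_atTop_atTop

lemma hasLogDensity_univ : HasLogDensity Set.univ 1 := by
  rw [hasLogDensity_iff]
  have h := (Real.tendsto_harmonic_sub_log.div_atTop tendsto_log_natCast).add_const 1
  rw [zero_add] at h
  refine h.congr' ?_
  filter_upwards [eventually_gt_atTop 1] with n hn
  have hlog : Real.log n ≠ 0 := (Real.log_pos (by exact_mod_cast hn)).ne'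
  have : logSum Set.univ n = (harmonic n : ℝ) := by
    rw [logSum_eq, harmonic_eq_sum_Icc]
    push_cast
    exact Finset.sum_congr rfl fun k _ => by simp [ind]
  rw [this]
  field_simp
  ring

lemma HasLogDensity.unique {A : Set ℤ} {d d' : ℝ} (h : HasLogDensity A d)
    (h' : HasLogDensity A d') : d = d' :=
  tendsto_nhds_unique h h'

lemma div_log_le_div_log {a b : ℝ} (h : a ≤ b) (n : ℕ) :
    a / Real.log n ≤ b / Real.log n :=
  div_le_div_of_nonneg_right h (Real.log_natCast_nonneg n)

lemma HasLogDensity.mono {A C : Set ℤ} {d d' : ℝ} (h : HasLogDensity A d)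
    (h' : HasLogDensity C d') (hAC : A ⊆ C) : d ≤ d' :=
  le_of_tendsto_of_tendsto' (hasLogDensity_iff.1 h) (hasLogDensity_iff.1 h') fun n =>
    div_log_le_div_log (logSum_mono hAC n) n

lemma HasLogDensity.nonneg {A : Set ℤ} {d : ℝ} (h : HasLogDensity A d) : 0 ≤ d :=
  ge_of_tendsto' (hasLogDensity_iff.1 h) fun n =>
    div_nonneg (logSum_nonneg A n) (Real.log_natCast_nonneg n)

lemma HasLogDensity.le_add {A C D : Set ℤ} {a c d : ℝ} (hA : HasLogDensity A a)
    (hC : HasLogDensity C c) (hD : HasLogDensity D d) (h : A ⊆ C ∪ D) : a ≤ c + d :=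
  le_of_tendsto_of_tendsto' (hasLogDensity_iff.1 hA)
    ((hasLogDensity_iff.1 hC).add (hasLogDensity_iff.1 hD)) fun n => by
      rw [← add_div]
      exact div_log_le_div_log ((logSum_mono h n).trans (logSum_union_le C D n)) n

lemma HasLogDensity.diff {A C : Set ℤ} {d d' : ℝ} (h : HasLogDensity A d)
    (h' : HasLogDensity C d') (hCA : C ⊆ A) : HasLogDensity (A \ C) (d - d') := by
  rw [hasLogDensity_iff] at *
  refine (h.sub h').congr fun n => ?_
  rw [logSum_diff hCA, sub_div]

lemma HasLogDensity.compl {A : Set ℤ} {d : ℝ} (h : HasLogDensity A d) :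
    HasLogDensity Aᶜ (1 - d) := by
  rw [Set.compl_eq_univ_sdiff]
  exact hasLogDensity_univ.diff h (Set.subset_univ A)

/-- Sets of logarithmic density zero. -/
def Null (A : Set ℤ) : Prop := HasLogDensity A 0

lemma Null.mono {A C : Set ℤ} (h : Null C) (hAC : A ⊆ C) : Null A := by
  rw [Null, hasLogDensity_iff] at *
  exact squeeze_zero (fun n => div_nonneg (logSum_nonneg A n) (Real.log_natCast_nonneg n))
    (fun n => div_log_le_div_log (logSum_mono hAC n) n) h

/-- A set covered, up to a set of arbitrarily small density, is null. -/
lemma null_of_forall_subset {A : Set ℤ}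
    (h : ∀ ε > 0, ∃ C d, A ⊆ C ∧ HasLogDensity C d ∧ d < ε) : Null A := by
  rw [Null, hasLogDensity_iff]
  refine tendsto_order.2 ⟨fun a ha => ?_, fun a ha => ?_⟩
  · exact Eventually.of_forall fun n => ha.trans_le
      (div_nonneg (logSum_nonneg A n) (Real.log_natCast_nonneg n))
  · obtain ⟨C, d, hAC, hC, hd⟩ := h a ha
    filter_upwards [(hasLogDensity_iff.1 hC).eventually_lt_const hd] with n hn
    exact (div_log_le_div_log (logSum_mono hAC n) n).trans_lt hn

/-- The dilation `g A`. -/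
def dilate (g : ℕ) (A : Set ℤ) : Set ℤ := (fun n => (g : ℤ) * n) '' A

lemma logSum_dilate {g : ℕ} (hg : 0 < g) (A : Set ℤ) (n : ℕ) :
    logSum (dilate g A) n = (1 / g) * logSum A (n / g) := by
  classical
  have hset : (Finset.Icc 1 n).filter (fun k : ℕ => (k : ℤ) ∈ dilate g A) =
      ((Finset.Icc 1 (n / g)).filter fun k : ℕ => (k : ℤ) ∈ A).image fun k => g * k := by
    ext k
    simp only [Finset.mem_filter, Finset.mem_Icc, Finset.mem_image, dilate, Set.mem_image]
    constructor
    · rintro ⟨⟨h1, h2⟩, m, hm, hmk⟩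
      have hg' : (0 : ℤ) < g := by exact_mod_cast hg
      have hm0 : 0 < m := by
        by_contra hcon
        have : (g : ℤ) * m ≤ 0 := mul_nonpos_of_nonneg_of_nonpos hg'.le (not_lt.1 hcon)
        omega
      lift m to ℕ using hm0.le
      have hk : g * m = k := by exact_mod_cast hmk
      refine ⟨m, ⟨⟨by exact_mod_cast hm0, ?_⟩, hm⟩, hk⟩
      rw [Nat.le_div_iff_mul_le hg, mul_comm, hk]
      exact h2
    · rintro ⟨m, ⟨⟨h1, h2⟩, hm⟩, rfl⟩
      refine ⟨⟨Nat.mul_pos hg h1, ?_⟩, m, hm, by push_cast; ring⟩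
      rw [mul_comm]
      exact (Nat.le_div_iff_mul_le hg).1 h2
  rw [logSum, hset, Finset.sum_image fun a _ b _ h => Nat.eq_of_mul_eq_mul_left hg h, logSum,
    Finset.mul_sum]
  exact Finset.sum_congr (by congr) fun k _ => by push_cast; rw [one_div_mul_one_div]

lemma Null.dilate {A : Set ℤ} (h : Null A) {g : ℕ} (hg : 0 < g) : Null (dilate g A) := by
  rw [Null, hasLogDensity_iff] at *
  have h' : Tendsto (fun n : ℕ => (1 / (g : ℝ)) * (logSum A n / Real.log n)) atTop (𝓝 0) := by
    simpa using h.const_mul (1 / (g : ℝ))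
  refine squeeze_zero (fun n => div_nonneg (logSum_nonneg _ n) (Real.log_natCast_nonneg n))
    (fun n => ?_) h'
  rw [← mul_div_assoc, logSum_dilate hg]
  refine div_log_le_div_log (mul_le_mul_of_nonneg_left ?_ (by positivity)) n
  classical
  refine Finset.sum_le_sum_of_subset_of_nonneg (Finset.filter_subset_filter _
    (Finset.Icc_subset_Icc_right (Nat.div_le_self n g))) fun k _ _ => by positivity

/-- Sampling at `g * n` recovers the sum of `A` up to `n`, and `log (g n) / log n → 1`. -/
lemma Null.of_dilate {A : Set ℤ} {g : ℕ} (hg : 0 < g) (h : Null (BFree.dilate g A)) : Null A := by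
  rw [Null, hasLogDensity_iff] at *
  have hgn : Tendsto (fun n : ℕ => g * n) atTop atTop :=
    tendsto_id.const_mul_atTop' hg
  have h1 := (h.comp hgn).mul (((tendsto_const_nhds (x := Real.log g)).div_atTop
    tendsto_log_natCast).add_const 1 |>.const_mul (g : ℝ))
  rw [zero_mul] at h1
  refine h1.congr' ?_
  filter_upwards [eventually_gt_atTop 1] with n hn
  have hlog : 0 < Real.log n := Real.log_pos (by exact_mod_cast hn)
  have hlg : 0 ≤ Real.log g := Real.log_natCast_nonneg g
  have hg' : (0 : ℝ) < g := by exact_mod_cast hg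
  have hn' : (0 : ℝ) < n := by exact_mod_cast (zero_lt_one.trans hn)
  simp only [Function.comp]
  rw [logSum_dilate hg, Nat.mul_div_cancel_left _ hg, Nat.cast_mul, Real.log_mul hg'.ne' hn'.ne']
  have : Real.log g + Real.log n ≠ 0 := by positivity
  field_simp

/-! ### Periodic sets -/

/-- `A` is invariant under translation by `N`. -/
def PeriodicSet (A : Set ℤ) (N : ℕ) : Prop := ∀ n : ℤ, n + N ∈ A ↔ n ∈ A

lemma count_Ico_of_periodic {A : Set ℤ} {N : ℕ} (hA : PeriodicSet A N) (m : ℕ) :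
    ∑ n ∈ Finset.range N, ind A (m + n) = count A N := by
  classical
  have hp : Function.Periodic (fun k : ℕ => (k : ℤ) ∈ A) N := fun k => by
    simpa using hA k
  have h := Nat.filter_Ico_card_eq_of_periodic m N _ hp
  have h0 := Nat.filter_Ico_card_eq_of_periodic 0 N _ hp
  rw [← h0, zero_add, ← Finset.range_eq_Ico] at h
  have e : count A N = (Finset.filter (fun k : ℕ => (k : ℤ) ∈ A) (Finset.range N)).card := by
    rw [count]
  rw [e, ← h, ← Finset.sum_boole, Finset.sum_Ico_eq_sum_range]
  simp only [ind, add_tsub_cancel_left]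

lemma abs_sum_range_le_of_periodic {z : ℕ → ℝ} {N : ℕ} (hN : 0 < N) (hz : ∀ n, |z n| ≤ 1)
    (h0 : ∀ m, ∑ n ∈ Finset.range N, z (m + n) = 0) (n : ℕ) :
    |∑ i ∈ Finset.range n, z i| ≤ N := by
  induction n using Nat.strong_induction_on with
  | _ n ih =>
    rcases lt_or_ge n N with h | h
    · calc |∑ i ∈ Finset.range n, z i| ≤ ∑ i ∈ Finset.range n, |z i| := Finset.abs_sum_le_sum_abs _ _
        _ ≤ ∑ i ∈ Finset.range n, 1 := Finset.sum_le_sum fun i _ => hz i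
        _ = n := by simp
        _ ≤ N := by exact_mod_cast h.le
    · obtain ⟨m, rfl⟩ := Nat.exists_eq_add_of_le' h
      rw [Finset.sum_range_add, h0, add_zero]
      exact ih m (by omega)

lemma count_le (A : Set ℤ) (N : ℕ) : count A N ≤ N := by
  classical
  exact (Finset.card_filter_le _ _).trans (by simp)

/-- Dirichlet's test: subtracting the mean leaves a periodic sequence with bounded partial sums, so
its sum against `1 / k` converges and is negligible compared with `log n`. -/
lemma PeriodicSet.hasLogDensity {A : Set ℤ} {N : ℕ} (hN : 0 < N) (hA : PeriodicSet A N) :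
    HasLogDensity A (count A N / N) := by
  have hN' : (0 : ℝ) < N := by exact_mod_cast hN
  set d : ℝ := count A N / N with hd
  have hd0 : 0 ≤ d := by positivity
  have hd1 : d ≤ 1 := div_le_one_of_le₀ (by exact_mod_cast count_le A N) hN'.le
  have hz : ∀ n, |ind A (n + 1) - d| ≤ 1 := fun n => by
    rw [abs_le, ind]
    split_ifs <;> constructor <;> linarith
  have h0 : ∀ m, ∑ n ∈ Finset.range N, (ind A (m + n + 1) - d) = 0 := fun m => by
    rw [Finset.sum_sub_distrib]
    simp only [add_right_comm m _ 1]
    rw [count_Ico_of_periodic hA (m + 1), Finset.sum_const, Finset.card_range, nsmul_eq_mul, hd]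
    field_simp
    ring
  have hanti : Antitone fun n : ℕ => 1 / ((n : ℝ) + 1) := fun a b hab =>
    one_div_le_one_div_of_le (by positivity) (by gcongr)
  have hc := hanti.cauchySeq_series_mul_of_tendsto_zero_of_bounded
    tendsto_one_div_add_atTop_nhds_zero_nat (z := fun n => ind A (n + 1) - d) (b := N)
    (fun n => abs_sum_range_le_of_periodic hN hz h0 n)
  obtain ⟨c, hc⟩ := cauchySeq_tendsto_of_complete hc
  have hdiff : ∀ n, ∑ i ∈ Finset.range n, (1 / ((i : ℝ) + 1)) • (ind A (i + 1) - d) =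
      logSum A n - d * logSum Set.univ n := fun n => by
    rw [logSum_eq, logSum_eq, Finset.mul_sum, ← Finset.sum_sub_distrib,
      ← Finset.Ico_add_one_right_eq_Icc, Finset.sum_Ico_eq_sum_range]
    simp only [add_tsub_cancel_right, smul_eq_mul]
    refine Finset.sum_congr rfl fun i _ => ?_
    have : ind Set.univ (1 + i) = 1 := by simp [ind]
    rw [this, add_comm 1 i]
    push_cast
    ring
  simp only [hdiff] at hc
  rw [hasLogDensity_iff]
  have h1 := (hc.div_atTop tendsto_log_natCast).add
    ((hasLogDensity_iff.1 hasLogDensity_univ).const_mul d)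
  rw [zero_add, mul_one] at h1
  refine h1.congr fun n => ?_
  ring

/-! ### The Davenport–Erdős theorem -/

lemma exists_common_multiple {B : Set ℕ+} (hB : B.Finite) :
    ∃ Q : ℕ, 0 < Q ∧ (∀ b ∈ B, (b : ℕ) ∣ Q) ∧
      ∀ q : ℕ, (∀ b ∈ B, (b : ℕ).Coprime q) → Q.Coprime q := by
  refine ⟨∏ b ∈ hB.toFinset, (b : ℕ), Finset.prod_pos fun b _ => b.pos, fun b hb =>
    Finset.dvd_prod_of_mem (fun b : ℕ+ => (b : ℕ)) (hB.mem_toFinset.2 hb), fun q hq =>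
    Nat.Coprime.prod_left fun b hb => hq b (hB.mem_toFinset.1 hb)⟩

lemma periodicSet_free {B : Set ℕ+} {N : ℕ} (hB : ∀ b ∈ B, (b : ℕ) ∣ N) :
    PeriodicSet (free B) N := fun n => by
  simp only [mem_free]
  exact forall₂_congr fun b hb => not_congr
    (dvd_add_left (Int.natCast_dvd_natCast.2 (hB b hb)))

lemma PeriodicSet.inter {A C : Set ℤ} {N : ℕ} (hA : PeriodicSet A N) (hC : PeriodicSet C N) :
    PeriodicSet (A ∩ C) N := fun n => and_congr (hA n) (hC n)

lemma PeriodicSet.of_dvd {A : Set ℤ} {N M : ℕ} (hA : PeriodicSet A N) (h : N ∣ M) :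
    PeriodicSet A M := by
  obtain ⟨k, rfl⟩ := h
  intro n
  induction k with
  | zero => simp
  | succ k ih =>
    rw [← ih, ← hA (n + ((N * k : ℕ) : ℤ))]
    push_cast
    ring_nf

/-- The elements of `B` up to `x`. -/
def trunc (B : Set ℕ+) (x : ℕ) : Set ℕ+ := {b ∈ B | (b : ℕ) ≤ x}

lemma trunc_finite (B : Set ℕ+) (x : ℕ) : (trunc B x).Finite := by
  refine Set.Finite.of_finite_image ((Set.finite_Iic x).subset ?_)
    (f := fun b : ℕ+ => (b : ℕ)) PNat.coe_injective.injOn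
  rintro _ ⟨b, hb, rfl⟩
  exact hb.2

lemma trunc_subset (B : Set ℕ+) (x : ℕ) : trunc B x ⊆ B := fun _ h => h.1

lemma trunc_mono (B : Set ℕ+) {x y : ℕ} (h : x ≤ y) : trunc B x ⊆ trunc B y :=
  fun _ hb => ⟨hb.1, hb.2.trans h⟩

lemma trunc_union (B C : Set ℕ+) (x : ℕ) : trunc (B ∪ C) x = trunc B x ∪ trunc C x :=
  Set.ext fun _ => or_and_right

lemma logSum_free_trunc (B : Set ℕ+) (x : ℕ) : logSum (free (trunc B x)) x = logSum (free B) x := by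
  rw [logSum_eq, logSum_eq]
  refine Finset.sum_congr rfl fun k hk => ?_
  have : (k : ℤ) ∈ free (trunc B x) ↔ (k : ℤ) ∈ free B := by
    refine ⟨fun h => mem_free.2 fun b hb hbk => ?_, fun h => free_anti (trunc_subset B x) h⟩
    refine mem_free.1 h b ⟨hb, ?_⟩ hbk
    obtain ⟨h1, h2⟩ := Finset.mem_Icc.1 hk
    exact (Nat.le_of_dvd h1 (Int.natCast_dvd_natCast.1 hbk)).trans h2
  classical
  congr 1
  exact if_congr this rfl rfl

lemma exists_hasLogDensity_inter_free {P : Set ℤ} {N : ℕ} (hN : 0 < N) (hP : PeriodicSet P N)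
    {B : Set ℕ+} (hB : B.Finite) : ∃ d, HasLogDensity (P ∩ free B) d := by
  obtain ⟨Q, hQ, hBQ, -⟩ := exists_common_multiple hB
  exact ⟨_, ((hP.of_dvd (Dvd.intro _ rfl)).inter
    ((periodicSet_free hBQ).of_dvd (Dvd.intro_left N rfl))).hasLogDensity (Nat.mul_pos hN hQ)⟩

lemma exists_hasLogDensity_free_of_finite {B : Set ℕ+} (hB : B.Finite) :
    ∃ d, HasLogDensity (free B) d := by
  have h := exists_hasLogDensity_inter_free (P := Set.univ) one_pos (fun n => by simp) hB
  simpa only [Set.univ_inter] using h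

lemma HasLogDensity.mul_logSum_univ_le {B : Set ℕ+} (hB : B.Finite) {d : ℝ}
    (hd : HasLogDensity (free B) d) (x : ℕ) :
    d * logSum Set.univ x ≤ logSum (free B) x := by
  obtain ⟨Q, hQ, hBQ, -⟩ := exists_common_multiple hB
  -- Both the elements of `B` and all `k ≤ x` must divide the modulus.
  set R := Q * x.factorial with hR
  have hR0 : 0 < R := Nat.mul_pos hQ x.factorial_pos
  have hBR : ∀ b ∈ B, (b : ℕ) ∣ R := fun b hb => (hBQ b hb).mul_right _
  have hR2 : 0 < R ^ 2 := by positivity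
  have h := count_free_mul_logSum_univ_le (x := x) hR0 hBR fun k hk =>
    (Nat.dvd_factorial (Finset.mem_Icc.1 hk).1 (Finset.mem_Icc.1 hk).2).mul_left Q
  have hper := (periodicSet_free (B := B) (N := R ^ 2)
    fun b hb => (hBR b hb).trans (dvd_pow_self R two_ne_zero)).hasLogDensity hR2
  have hR2' : (0 : ℝ) < (R ^ 2 : ℕ) := by exact_mod_cast hR2
  rw [hd.unique hper, div_mul_eq_mul_div, div_le_iff₀ hR2']
  linarith

/-- **Davenport–Erdős**: the set of `B`-free integers has a logarithmic density, which is the limit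
of the densities for the finite truncations of `B`. -/
theorem davenport_erdos (B : Set ℕ+) : ∃ (d : ℝ) (e : ℕ → ℝ),
    (∀ x, HasLogDensity (free (trunc B x)) (e x)) ∧ Tendsto e atTop (𝓝 d) ∧
      HasLogDensity (free B) d := by
  choose e he using fun x => exists_hasLogDensity_free_of_finite (trunc_finite B x)
  have hanti : Antitone e := fun x y h => (he y).mono (he x) (free_anti (trunc_mono B h))
  have hbdd : BddBelow (Set.range e) := ⟨0, by rintro _ ⟨x, rfl⟩; exact (he x).nonneg⟩
  refine ⟨_, e, he, tendsto_atTop_ciInf hanti hbdd, ?_⟩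
  rw [hasLogDensity_iff]
  refine tendsto_order.2 ⟨fun a ha => ?_, fun a ha => ?_⟩
  -- Lower bound: up to `n` only the elements of `B` of size at most `n` matter, and the bound for
  -- this finite set holds at every `n`, with no error term depending on the set.
  · have h1 := (hasLogDensity_iff.1 hasLogDensity_univ).const_mul (⨅ i, e i)
    rw [mul_one] at h1
    filter_upwards [h1.eventually_const_lt ha] with n hn
    refine hn.trans_le ?_
    rw [← mul_div_assoc]
    refine div_log_le_div_log ?_ n
    rw [← logSum_free_trunc]
    refine le_trans ?_ ((he n).mul_logSum_univ_le (trunc_finite B n) n)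
    exact mul_le_mul_of_nonneg_right (ciInf_le hbdd n) (logSum_nonneg _ n)
  -- Upper bound: `free B` is contained in each `free (trunc B x)`.
  · obtain ⟨x, hx⟩ := exists_lt_of_ciInf_lt ha
    filter_upwards [(hasLogDensity_iff.1 (he x)).eventually_lt_const hx] with n hn
    exact (div_log_le_div_log (logSum_mono (free_anti (trunc_subset B x)) n) n).trans_lt hn

/-- Replacing `B` by its truncation adds at most a set of density `e x - d`, which tends to zero by
Davenport–Erdős, whatever `P` is. -/
lemma null_inter_free_iff {B : Set ℕ+} {P : Set ℤ} {p : ℕ → ℝ}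
    (hp : ∀ x, HasLogDensity (P ∩ free (trunc B x)) (p x)) :
    Null (P ∩ free B) ↔ Tendsto p atTop (𝓝 0) := by
  constructor
  · intro h
    obtain ⟨d, e, he, hed, hd⟩ := davenport_erdos B
    have h0 : Tendsto (fun x => 0 + (e x - d)) atTop (𝓝 0) := by
      simpa using hed.sub_const d
    refine squeeze_zero (fun x => (hp x).nonneg) (fun x => ?_) h0
    refine (hp x).le_add h ((he x).diff hd (free_anti (trunc_subset B x))) fun n hn => ?_
    by_cases hB : n ∈ free B
    · exact .inl ⟨hn.1, hB⟩
    · exact .inr ⟨hn.2, hB⟩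
  · intro h
    refine null_of_forall_subset fun ε hε => ?_
    obtain ⟨x, hx⟩ := (h.eventually_lt_const hε).exists
    exact ⟨_, _, Set.inter_subset_inter_right P (free_anti (trunc_subset B x)), hp x, hx⟩

/-! ### Behrend's inequality and its consequences -/

lemma mul_le_of_hasLogDensity_of_finite {B C : Set ℕ+} (hB : B.Finite) (hC : C.Finite) {b c d : ℝ}
    (hb : HasLogDensity (free B) b) (hc : HasLogDensity (free C) c)
    (hd : HasLogDensity (free (B ∪ C)) d) : b * c ≤ d := by
  obtain ⟨N, hN, hBC, -⟩ := exists_common_multiple (hB.union hC)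
  have hBN : ∀ b ∈ B, (b : ℕ) ∣ N := fun b hb => hBC b (.inl hb)
  have hCN : ∀ b ∈ C, (b : ℕ) ∣ N := fun b hb => hBC b (.inr hb)
  have h := count_free_mul_count_free_le hN hBN hCN
  have hN' : (0 : ℝ) < N := by exact_mod_cast hN
  rw [hb.unique ((periodicSet_free hBN).hasLogDensity hN),
    hc.unique ((periodicSet_free hCN).hasLogDensity hN),
    hd.unique ((periodicSet_free hBC).hasLogDensity hN), div_mul_div_comm,
    div_le_div_iff₀ (by positivity) hN']
  nlinarith

/-- Behrend's inequality passes to the limit along truncations, so the product of the densities of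
the two free sets is at most that of their intersection. -/
lemma null_free_or_of_union {B C : Set ℕ+} (h : Null (free (B ∪ C))) :
    Null (free B) ∨ Null (free C) := by
  obtain ⟨b, e, he, heb, hb⟩ := davenport_erdos B
  obtain ⟨c, f, hf, hfc, hc⟩ := davenport_erdos C
  obtain ⟨d, g, hg, hgd, hd⟩ := davenport_erdos (B ∪ C)
  have hle : b * c ≤ d := le_of_tendsto_of_tendsto' (heb.mul hfc) hgd fun x => by
    have hgx := hg x
    rw [trunc_union] at hgx
    exact mul_le_of_hasLogDensity_of_finite (trunc_finite B x) (trunc_finite C x) (he x) (hf x) hgx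
  rw [hd.unique h] at hle
  have h0 : b * c = 0 := le_antisymm hle (mul_nonneg hb.nonneg hc.nonneg)
  rcases mul_eq_zero.1 h0 with rfl | rfl
  · exact .inl hb
  · exact .inr hc

lemma not_null_univ : ¬ Null Set.univ := fun h => one_ne_zero (hasLogDensity_univ.unique h)

lemma exists_null_free_of_iUnion {ι : Type*} (s : Finset ι) (C : ι → Set ℕ+)
    (h : Null (free (⋃ i ∈ s, C i))) : ∃ i ∈ s, Null (free (C i)) := by
  classical
  induction s using Finset.induction_on with
  | empty =>
    refine (not_null_univ ?_).elim
    simpa [free, multiples] using h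
  | insert i s hi ih =>
    rw [Finset.set_biUnion_insert] at h
    rcases null_free_or_of_union h with h | h
    · exact ⟨i, Finset.mem_insert_self i s, h⟩
    · obtain ⟨j, hj, hj'⟩ := ih h
      exact ⟨j, Finset.mem_insert_of_mem hj, hj'⟩

lemma not_null_free_singleton {a : ℕ+} (ha : a ≠ 1) : ¬ Null (free {a}) := by
  intro h
  have h1 := (periodicSet_free (B := {a}) (N := a) (by simp)).hasLogDensity a.pos
  have h0 := h1.unique h
  have ha' : (0 : ℝ) < (a : ℕ) := by exact_mod_cast a.pos
  rw [div_eq_zero_iff, or_iff_left ha'.ne'] at h0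
  have hc : count (free {a}) a = 0 := by exact_mod_cast h0
  classical
  rw [count, Finset.card_eq_zero, Finset.filter_eq_empty_iff] at hc
  have ha1 : 1 < (a : ℕ) := by
    have := lt_of_le_of_ne one_le (Ne.symm ha)
    exact_mod_cast this
  refine hc (Finset.mem_range.2 ha1) (mem_free.2 fun b hb hdvd => ?_)
  rw [Set.mem_singleton_iff.1 hb] at hdvd
  have := Int.natCast_dvd_natCast.1 hdvd
  exact ha1.ne' (Nat.dvd_one.1 this)

/-- The arithmetic progression `r + q ℤ`. -/
def progression (r : ℤ) (q : ℕ) : Set ℤ := {n | (q : ℤ) ∣ n - r}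

lemma periodicSet_progression (r : ℤ) (q : ℕ) : PeriodicSet (progression r q) q := fun n => by
  rw [progression, Set.mem_ofPred_eq, Set.mem_ofPred_eq, add_sub_right_comm, dvd_add_left dvd_rfl]

/-- Being `B`-free depends only on the residue modulo some `L` coprime to `q`. By the Chinese
remainder theorem each such residue class meets `r + q ℤ`, so the progression gets at least its
share `1 / q`. -/
lemma le_mul_of_hasLogDensity_progression {B : Set ℕ+} (hB : B.Finite) {q : ℕ} (hq : 0 < q)
    (hcop : ∀ b ∈ B, (b : ℕ).Coprime q) (r : ℤ) {d e : ℝ} (hd : HasLogDensity (free B) d)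
    (he : HasLogDensity (progression r q ∩ free B) e) : d ≤ q * e := by
  obtain ⟨L, hL, hBL, hLq⟩ := exists_common_multiple hB
  have hLq := hLq q hcop
  have hN : 0 < q * L := Nat.mul_pos hq hL
  have hN' : (0 : ℝ) < (q * L : ℕ) := by exact_mod_cast hN
  have hF := periodicSet_free hBL
  have hFN : PeriodicSet (free B) (q * L) := hF.of_dvd (Dvd.intro_left q rfl)
  have hPN : PeriodicSet (progression r q ∩ free B) (q * L) :=
    ((periodicSet_progression r q).of_dvd (Dvd.intro L rfl)).inter hFN
  rw [hd.unique (hFN.hasLogDensity hN), he.unique (hPN.hasLogDensity hN), ← mul_div_assoc]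
  refine div_le_div_of_nonneg_right ?_ hN'.le
  have hsum : (q : ℝ) * count (progression r q ∩ free B) (q * L) =
      ∑ n ∈ Finset.range (q * L), ∑ j ∈ Finset.range q, ind (progression r q ∩ free B) (L * j + n) := by
    rw [Finset.sum_comm, Finset.sum_congr rfl fun j _ => count_Ico_of_periodic hPN (L * j)]
    simp
  rw [hsum, count_eq_sum]
  refine Finset.sum_le_sum fun n _ => ?_
  by_cases hn : (n : ℤ) ∈ free B
  · have : NeZero q := ⟨hq.ne'⟩
    -- The solution of `L z + n ≡ r` modulo `q`.
    let z : ZMod q := ((r - n : ℤ) : ZMod q) * (L : ZMod q)⁻¹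
    have hmem : ((L * z.val + n : ℕ) : ℤ) ∈ progression r q ∩ free B := by
      constructor
      · rw [progression, Set.mem_ofPred_eq, ← ZMod.intCast_zmod_eq_zero_iff_dvd]
        have hu := ZMod.coe_mul_inv_eq_one L hLq
        push_cast
        rw [ZMod.natCast_zmod_val]
        simp only [z]
        push_cast
        linear_combination ((r : ZMod q) - n) * hu
      · have := (hF.of_dvd (Dvd.intro z.val rfl)) n
        rw [add_comm (L * z.val) n]
        push_cast at this ⊢
        exact this.2 hn
    have h1 : ind (free B) n = ind (progression r q ∩ free B) (L * z.val + n) := by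
      rw [ind, ind, if_pos hn, if_pos hmem]
    rw [h1]
    exact Finset.single_le_sum (f := fun j => ind (progression r q ∩ free B) (L * j + n))
      (fun j _ => ind_nonneg _ _) (Finset.mem_range.2 (ZMod.val_lt z))
  · rw [ind, if_neg hn]
    exact Finset.sum_nonneg fun j _ => ind_nonneg _ _

lemma null_free_of_progression {C : Set ℕ+} {q : ℕ} (hq : 0 < q)
    (hcop : ∀ b ∈ C, (b : ℕ).Coprime q) {r : ℤ} (h : Null (progression r q ∩ free C)) :
    Null (free C) := by
  choose p hp using fun x =>
    exists_hasLogDensity_inter_free hq (periodicSet_progression r q) (trunc_finite C x)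
  have hp0 := ((null_inter_free_iff hp).1 h).const_mul (q : ℝ)
  rw [mul_zero] at hp0
  obtain ⟨d, e, he, hed, hd⟩ := davenport_erdos C
  have : d ≤ 0 := le_of_tendsto_of_tendsto' hed hp0 fun x =>
    le_mul_of_hasLogDensity_progression (trunc_finite C x) hq (fun b hb => hcop b hb.1) r (he x)
      (hp x)
  rwa [le_antisymm this hd.nonneg] at hd

/-! ### Tautness -/

lemma multiples_eq_compl_free (B : Set ℕ+) : multiples B = (free B)ᶜ := (compl_compl _).symm

lemma progression_inter_free_eq {B : Set ℕ+} {b : ℕ+} (hb : b ∈ B) :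
    progression 0 b ∩ free (B \ {b}) = free (B \ {b}) \ free B := by
  ext n
  simp only [progression, sub_zero, Set.mem_inter_iff, Set.mem_ofPred_eq]
  constructor
  · rintro ⟨h1, h2⟩
    exact ⟨h2, fun h => mem_free.1 h b hb h1⟩
  · rintro ⟨h1, h2⟩
    refine ⟨by_contra fun hbn => h2 (mem_free.2 fun c hc hcn => ?_), h1⟩
    by_cases h : c = b
    · exact hbn (h ▸ hcn)
    · exact mem_free.1 h1 c ⟨hc, h⟩ hcn

/-- By Davenport–Erdős all the densities exist, and the drop caused by removing `b` is the density
of the multiples of `b` that no other element divides. -/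
lemma taut_iff {B : Set ℕ+} :
    Taut B ↔ ∀ b ∈ B, ¬ Null (progression 0 b ∩ free (B \ {b})) := by
  refine forall₂_congr fun b hb => ?_
  obtain ⟨d, -, -, -, hd⟩ := davenport_erdos B
  obtain ⟨d', -, -, -, hd'⟩ := davenport_erdos (B \ {b})
  have hm := hd.compl
  have hm' := hd'.compl
  rw [← multiples_eq_compl_free] at hm hm'
  have hsub : free B ⊆ free (B \ {b}) := free_anti Set.sdiff_subset
  have hdiff := hd'.diff hd hsub
  rw [progression_inter_free_eq hb]
  constructor
  · rintro ⟨e, e', he, he', hlt⟩ h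
    rw [he.unique hm', he'.unique hm] at hlt
    have := hdiff.unique h
    linarith
  · intro h
    refine ⟨_, _, hm', hm, lt_of_le_of_ne ?_ fun heq => h ?_⟩
    · have := hd.mono hd' hsub
      linarith
    · have h0 : d' - d = 0 := by linarith
      rw [h0] at hdiff
      exact hdiff

lemma null_free_diff_singleton {A : Set ℕ+} (hA : Null (free A)) (h1 : (1 : ℕ+) ∉ A) {a : ℕ+}
    (ha : a ∈ A) : Null (free (A \ {a})) := by
  have h : A = A \ {a} ∪ {a} := (Set.sdiff_union_of_subset (Set.singleton_subset_iff.2 ha)).symm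
  rw [h] at hA
  exact (null_free_or_of_union hA).resolve_right
    (not_null_free_singleton fun h => h1 (h ▸ ha))

lemma nonempty_of_null_free {A : Set ℕ+} (hA : Null (free A)) : A.Nonempty := by
  rw [Set.nonempty_iff_ne_empty]
  rintro rfl
  exact not_null_univ (by simpa [free, multiples] using hA)

lemma progression_inter_free_subset_dilate {B A : Set ℕ+} {g : ℕ+} {r : ℤ} {l : ℕ}
    (hr : (g : ℤ) ∣ r) (hl : (g : ℕ) ∣ l) (h : ∀ a ∈ A, a * g ∈ B) :
    progression r l ∩ free B ⊆ dilate g (free A) := by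
  rintro n ⟨hn, hnB⟩
  obtain ⟨m, rfl⟩ : (g : ℤ) ∣ n := by
    have h2 := (Int.natCast_dvd_natCast.2 hl).trans hn
    simpa using dvd_add h2 hr
  refine ⟨m, mem_free.2 fun a ha ham => mem_free.1 hnB _ (h a ha) ?_, rfl⟩
  rw [PNat.mul_coe, Nat.cast_mul, mul_comm]
  exact mul_dvd_mul_left _ ham

/-- A taut set contains no dilate of a Behrend set. -/
lemma not_taut_of_dilate {B A : Set ℕ+} {g : ℕ+} (h : ∀ a ∈ A, a * g ∈ B) (h1 : (1 : ℕ+) ∉ A)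
    (hA : Null (free A)) : ¬ Taut B := by
  obtain ⟨a, ha⟩ := nonempty_of_null_free hA
  rw [taut_iff]
  push Not
  refine ⟨a * g, h a ha, ((null_free_diff_singleton hA h1 ha).dilate g.pos).mono
    (progression_inter_free_subset_dilate (dvd_zero _) (by simp) fun a' ha' =>
      ⟨h a' ha'.1, fun heq => ha'.2 (mul_right_cancel heq)⟩)⟩

/-- If almost all of a progression is covered by multiples of `B`, but not by an element of `B`
that contains it, then `B` contains a dilate of a Behrend set. -/
lemma exists_dilate_of_null {B : Set ℕ+} {n : ℤ} {l : ℕ} (hl : 0 < l)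
    (hnull : Null (progression n l ∩ free B))
    (hn : ∀ b ∈ B, (b : ℕ) ∣ l → ¬ (b : ℤ) ∣ n) :
    ∃ (g : ℕ+) (A : Set ℕ+), (∀ a ∈ A, a * g ∈ B) ∧ (1 : ℕ+) ∉ A ∧ Null (free A) := by
  set g : ℕ := Int.gcd n l with hgdef
  have hg : 0 < g := Int.gcd_pos_of_ne_zero_right _ (by exact_mod_cast hl.ne')
  have hgl : g ∣ l := Int.natCast_dvd_natCast.1 (Int.gcd_dvd_right n l)
  have hgn : (g : ℤ) ∣ n := Int.gcd_dvd_left n l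
  obtain ⟨q, hq⟩ := hgl
  obtain ⟨r, hr⟩ := hgn
  have hq0 : 0 < q := Nat.pos_of_ne_zero fun h => by simp [h] at hq; omega
  have hrq : IsCoprime r (q : ℤ) := by
    rw [Int.isCoprime_iff_gcd_eq_one]
    have h : Int.gcd ((g : ℤ) * r) ((g : ℤ) * q) = g := by
      rw [← hr, ← Nat.cast_mul, ← hq]
    rw [Int.gcd_mul_left, Int.natAbs_natCast] at h
    exact Nat.eq_of_mul_eq_mul_left hg (by rw [h, mul_one])
  -- For `g' = gcd (b, g)`, `b` divides `g m` exactly when `b / g'` divides `m`. The quotients are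
  -- sorted by `g'`, keeping only those coprime to `q`.
  let C : ℕ → Set ℕ+ := fun g' =>
    {c | (∃ b ∈ B, Nat.gcd b g = g' ∧ (b : ℕ) = c * g') ∧ (c : ℕ).Coprime q}
  have hsub : dilate g (progression r q ∩ free (⋃ g' ∈ g.divisors, C g')) ⊆
      progression n l ∩ free B := by
    rintro _ ⟨m, ⟨hm, hmC⟩, rfl⟩
    refine ⟨?_, mem_free.2 fun b hb hbm => ?_⟩
    · rw [progression, Set.mem_ofPred_eq, hq, hr, Nat.cast_mul, ← mul_sub]
      exact mul_dvd_mul_left _ hm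
    · have hg'0 : 0 < Nat.gcd b g := Nat.gcd_pos_of_pos_right _ hg
      obtain ⟨c, hc⟩ := Nat.gcd_dvd_left (b : ℕ) g
      have hc0 : 0 < c := Nat.pos_of_ne_zero fun h => by
        rw [h, mul_zero] at hc
        exact b.ne_zero hc
      have hcm : (c : ℤ) ∣ m := by
        have h1 : (b : ℕ) ∣ g * m.natAbs := by
          have := Int.natAbs_dvd_natAbs.2 hbm
          simpa [Int.natAbs_mul] using this
        have h2 : (b : ℕ) / Nat.gcd b g ∣ m.natAbs := by
          refine (Nat.coprime_div_gcd_div_gcd hg'0).dvd_of_dvd_mul_left ?_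
          refine Nat.dvd_of_mul_dvd_mul_left hg'0 ?_
          rw [← mul_assoc, Nat.mul_div_cancel' (Nat.gcd_dvd_left _ _),
            Nat.mul_div_cancel' (Nat.gcd_dvd_right _ _)]
          exact h1
        rw [Nat.div_eq_of_eq_mul_right hg'0 hc] at h2
        exact Int.natCast_dvd.2 h2
      refine mem_free.1 hmC ⟨c, hc0⟩ ?_ hcm
      refine Set.mem_biUnion (Finset.mem_coe.2 (Nat.mem_divisors.2
        ⟨Nat.gcd_dvd_right (b : ℕ) g, hg.ne'⟩)) ⟨⟨b, hb, rfl, by rw [mul_comm]; exact hc⟩, ?_⟩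
      -- A quotient not coprime to `q` plays no role: `c` divides `m ≡ r` modulo `q`, and `r` is
      -- coprime to `q`.
      rw [← Nat.isCoprime_iff_coprime]
      refine IsCoprime.of_isCoprime_of_dvd_left ?_ hcm
      obtain ⟨k, hk⟩ := hm
      have : m = r + q * k := by linarith
      rw [this]
      exact IsCoprime.add_mul_left_left hrq k
  have h1 := Null.of_dilate hg (hnull.mono hsub)
  have h2 := null_free_of_progression hq0 (fun b hb => by
    obtain ⟨g', -, h⟩ := Set.mem_iUnion₂.1 hb
    exact h.2) h1
  obtain ⟨g', hg', hC⟩ := exists_null_free_of_iUnion _ _ h2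
  have hg'0 : 0 < g' := Nat.pos_of_mem_divisors hg'
  refine ⟨Nat.toPNat g' hg'0, C g', ?_, ?_, hC⟩
  · rintro a ⟨⟨b, hb, -, hba⟩, -⟩
    have : a * Nat.toPNat g' hg'0 = b := PNat.eq (by rw [PNat.mul_coe, hba]; rfl)
    rwa [this]
  -- If `1` were a quotient, then `b` would divide `g`, hence both `l` and `n`, against `hn`.
  · rintro ⟨⟨b, hb, hbg, hb1⟩, -⟩
    rw [PNat.one_coe, one_mul, ← hbg] at hb1
    have hbg : (b : ℕ) ∣ g := hb1 ▸ Nat.gcd_dvd_right (b : ℕ) g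
    refine hn b hb (hq ▸ hbg.mul_right q) ?_
    rw [hr]
    exact (Int.natCast_dvd_natCast.2 hbg).mul_right r

lemma Taut.not_null_progression {B : Set ℕ+} (hB : Taut B) {n : ℤ} {l : ℕ} (hl : 0 < l)
    (hn : ∀ b ∈ B, (b : ℕ) ∣ l → ¬ (b : ℤ) ∣ n) : ¬ Null (progression n l ∩ free B) := fun h => by
  obtain ⟨g, A, hgA, h1, hA⟩ := exists_dilate_of_null hl h hn
  exact not_taut_of_dilate hgA h1 hA hB

/-- A primitive set that is not taut almost covers a progression containing a `B`-free number. -/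
lemma Primitive.exists_null_progression_of_not_taut {B : Set ℕ+} (hB : Primitive B)
    (h : ¬ Taut B) : ∃ n : ℤ, n ∈ free B ∧ ∃ b ∈ B, Null (progression n b ∩ free B) := by
  rw [taut_iff] at h
  push Not at h
  obtain ⟨b, hb, hnull⟩ := h
  -- Here the progression is `b ℤ`; primitivity ensures that no other element of `B` divides `b`.
  obtain ⟨g, A, hgA, h1, hA⟩ := exists_dilate_of_null b.pos hnull fun c hc hcb _ =>
    hc.2 (hB c hc.1 b hb hcb)
  obtain ⟨a, ha⟩ := nonempty_of_null_free hA
  -- The free number is `g` itself: a divisor `c ∈ B` of `g` divides `a * g`, so equals it by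
  -- primitivity, forcing `a = 1`. The progression `g + a g ℤ` consists of multiples of `g`, almost
  -- all of which are covered by `g A`.
  refine ⟨g, mem_free.2 fun c hc hcg => ?_, a * g, (hgA a ha).1, (hA.dilate g.pos).mono
    (progression_inter_free_subset_dilate dvd_rfl (by simp) fun a ha => (hgA a ha).1)⟩
  have hcg : (c : ℕ) ∣ g := Int.natCast_dvd_natCast.1 hcg
  have heq := hB c hc _ (hgA a ha).1 (hcg.trans (by simp))
  rw [heq, PNat.mul_coe] at hcg
  have ha1 : (a : ℕ) ∣ 1 := Nat.dvd_of_mul_dvd_mul_right g.pos (by rwa [one_mul])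
  exact h1 (PNat.coe_eq_one_iff.1 (Nat.dvd_one.1 ha1) ▸ ha)

/-! ### Haar measure of cylinder sets -/

instance isAddHaarMeasure_haarH (B : Set ℕ+) : (haarH B).IsAddHaarMeasure :=
  inferInstanceAs (Measure.addHaarMeasure _).IsAddHaarMeasure

instance isProbabilityMeasure_haarH (B : Set ℕ+) : IsProbabilityMeasure (haarH B) :=
  ⟨by simpa [haarH] using Measure.addHaarMeasure_self (G := H B) (K₀ := ⊤)⟩

lemma denseRange_diag (B : Set ℕ+) : DenseRange (diag B) := by
  rw [DenseRange, Subtype.dense_iff]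
  intro h hh
  have : Subtype.val '' Set.range (diag B) = ((diagProd B).range : Set (ProdGroup B)) := by
    rw [← Set.range_comp]
    rfl
  exact (congrArg (fun s => h ∈ closure s) this).mpr hh

lemma continuous_coord (B : Set ℕ+) (b : B) : Continuous fun h : H B => (h : ProdGroup B) b :=
  (continuous_apply b).comp continuous_subtype_val

/-- The subgroup of elements of `H` that vanish at the coordinates in `T`. -/
def vanishing {B : Set ℕ+} (T : Finset B) : AddSubgroup (H B) where
  carrier := {h | ∀ b ∈ T, (h : ProdGroup B) b = 0}
  zero_mem' := fun _ _ => rfl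
  add_mem' := fun hx hy b hb => by
    rw [AddSubgroup.coe_add, Pi.add_apply, hx b hb, hy b hb, add_zero]
  neg_mem' := fun hx b hb => by
    rw [NegMemClass.coe_neg, Pi.neg_apply, hx b hb, neg_zero]

lemma mem_vanishing {B : Set ℕ+} {T : Finset B} {h : H B} :
    h ∈ vanishing T ↔ ∀ b ∈ T, (h : ProdGroup B) b = 0 := Iff.rfl

lemma isOpen_vanishing {B : Set ℕ+} (T : Finset B) : IsOpen (vanishing T : Set (H B)) := by
  have : (vanishing T : Set (H B)) = ⋂ b ∈ T, {h : H B | (h : ProdGroup B) b = 0} := by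
    ext h
    simp [mem_vanishing]
  rw [this]
  exact isOpen_biInter_finset fun b _ =>
    (isOpen_discrete {(0 : ZMod (b : ℕ+))}).preimage (continuous_coord B b)

/-- The least common multiple of the elements of `T`. -/
def modulus {B : Set ℕ+} (T : Finset B) : ℕ := T.lcm fun b => ((b : ℕ+) : ℕ)

lemma modulus_pos {B : Set ℕ+} (T : Finset B) : 0 < modulus T :=
  Nat.pos_of_ne_zero fun h => by
    obtain ⟨b, -, hb⟩ := Finset.lcm_eq_zero_iff.1 h
    exact (b : ℕ+).ne_zero hb

lemma modulus_dvd_iff {B : Set ℕ+} (T : Finset B) (n : ℤ) :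
    (modulus T : ℤ) ∣ n ↔ ∀ b ∈ T, (((b : ℕ+) : ℕ) : ℤ) ∣ n := by
  simp only [Int.natCast_dvd, modulus, Finset.lcm_dvd_iff]

lemma diag_sub_mem_vanishing_iff {B : Set ℕ+} (T : Finset B) (m n : ℤ) :
    diag B m - diag B n ∈ vanishing T ↔ (modulus T : ℤ) ∣ m - n := by
  rw [modulus_dvd_iff, mem_vanishing]
  refine forall₂_congr fun b _ => ?_
  rw [← ZMod.intCast_zmod_eq_zero_iff_dvd, Int.cast_sub]
  rfl

lemma exists_sub_diag_mem_vanishing {B : Set ℕ+} (T : Finset B) (h : H B) :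
    ∃ n : ℕ, n < modulus T ∧ h - diag B n ∈ vanishing T := by
  have hopen : IsOpen {h' : H B | h - h' ∈ vanishing T} :=
    (isOpen_vanishing T).preimage (continuous_const.sub continuous_id)
  obtain ⟨n, hn⟩ := (denseRange_diag B).exists_mem_open hopen ⟨h, by simp⟩
  have hL : (0 : ℤ) < modulus T := by exact_mod_cast modulus_pos T
  have hmod0 := Int.emod_nonneg n hL.ne'
  refine ⟨(n % modulus T).toNat, ?_, ?_⟩
  · have := Int.emod_lt_of_pos n hL
    omega
  · rw [Int.toNat_of_nonneg hmod0, ← sub_add_sub_cancel h (diag B n)]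
    refine add_mem hn ((diag_sub_mem_vanishing_iff T _ _).2 (Int.dvd_self_sub_emod))

/-- `E` is a union of cosets of `vanishing T`. -/
def IsCylinder {B : Set ℕ+} (T : Finset B) (E : Set (H B)) : Prop :=
  ∀ h h' : H B, h - h' ∈ vanishing T → h' ∈ E → h ∈ E

lemma IsCylinder.isOpen {B : Set ℕ+} {T : Finset B} {E : Set (H B)} (hE : IsCylinder T E) :
    IsOpen E := by
  refine isOpen_iff_mem_nhds.2 fun h hh => ?_
  have hopen : IsOpen {h' : H B | h' - h ∈ vanishing T} :=
    (isOpen_vanishing T).preimage (continuous_id.sub continuous_const)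
  exact mem_of_superset (hopen.mem_nhds (by simp)) fun h' hh' => hE h' h hh' hh

/-- The cosets of `vanishing T` are represented by `Δ(n)` for `0 ≤ n < modulus T`, are disjoint, and
have equal measure by invariance. -/
lemma haarH_cylinder_aux {B : Set ℕ+} {T : Finset B} {E : Set (H B)} (hE : IsCylinder T E) :
    (haarH B).real E = count (diag B ⁻¹' E) (modulus T) * (haarH B).real (vanishing T) := by
  classical
  set s := (Finset.range (modulus T)).filter fun k : ℕ => (k : ℤ) ∈ diag B ⁻¹' E with hs
  have hEq : E = ⋃ n ∈ s, (fun h => -diag B n + h) ⁻¹' (vanishing T : Set (H B)) := by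
    ext h
    simp only [Set.mem_iUnion, Set.mem_preimage, SetLike.mem_coe, hs, Finset.mem_filter,
      Finset.mem_range, exists_prop, neg_add_eq_sub]
    constructor
    · intro hh
      obtain ⟨n, hn, hn'⟩ := exists_sub_diag_mem_vanishing T h
      refine ⟨n, ⟨hn, hE _ _ ?_ hh⟩, hn'⟩
      rw [← neg_sub]
      exact neg_mem hn'
    · rintro ⟨n, ⟨-, hn⟩, hn'⟩
      exact hE _ _ hn' hn
  have hdisj : (s : Set ℕ).PairwiseDisjoint
      fun n : ℕ => (fun h => -diag B n + h) ⁻¹' (vanishing T : Set (H B)) := by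
    intro m hm n hn hmn
    refine Set.disjoint_left.2 fun h h1 h2 => hmn ?_
    simp only [Set.mem_preimage, SetLike.mem_coe, neg_add_eq_sub] at h1 h2
    have h3 := sub_mem h2 h1
    rw [sub_sub_sub_cancel_left, diag_sub_mem_vanishing_iff] at h3
    have hm' := Finset.mem_range.1 (Finset.mem_filter.1 hm).1
    have hn' := Finset.mem_range.1 (Finset.mem_filter.1 hn).1
    have h4 : (m : ℤ) ≡ n [ZMOD modulus T] := (Int.modEq_iff_dvd.2 (by
      rw [← dvd_neg, neg_sub]; exact h3))
    exact Nat.ModEq.eq_of_lt_of_lt (Int.natCast_modEq_iff.1 h4) hm' hn'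
  have hmeas : ∀ n ∈ s, MeasurableSet ((fun h => -diag B (n : ℕ) + h) ⁻¹'
      (vanishing T : Set (H B))) := fun n _ =>
    ((isOpen_vanishing T).preimage (continuous_const.add continuous_id)).measurableSet
  conv_lhs => rw [hEq]
  rw [measureReal_biUnion_finset hdisj hmeas]
  have : ∀ n ∈ s, (haarH B).real ((fun h => -diag B (n : ℕ) + h) ⁻¹' (vanishing T : Set (H B))) =
      (haarH B).real (vanishing T) := fun n _ => by
    rw [measureReal_def, measureReal_def, measure_preimage_add]
  rw [Finset.sum_congr rfl this, Finset.sum_const, nsmul_eq_mul, count]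

lemma count_univ (N : ℕ) : count Set.univ N = N := by
  simp [count]

lemma haarH_cylinder {B : Set ℕ+} {T : Finset B} {E : Set (H B)} (hE : IsCylinder T E) :
    (haarH B).real E = count (diag B ⁻¹' E) (modulus T) / modulus T := by
  have hL : (0 : ℝ) < modulus T := by exact_mod_cast modulus_pos T
  have h1 := haarH_cylinder_aux (T := T) (E := Set.univ) fun _ _ _ _ => Set.mem_univ _
  rw [Set.preimage_univ, count_univ, probReal_univ] at h1
  rw [haarH_cylinder_aux hE, eq_div_iff hL.ne', mul_assoc, mul_comm _ (modulus T : ℝ), ← h1,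
    mul_one]

lemma IsCylinder.periodicSet {B : Set ℕ+} {T : Finset B} {E : Set (H B)} (hE : IsCylinder T E) :
    PeriodicSet (diag B ⁻¹' E) (modulus T) := fun n =>
  ⟨hE _ _ ((diag_sub_mem_vanishing_iff T _ _).2 (by simp)),
    hE _ _ ((diag_sub_mem_vanishing_iff T _ _).2 (by simp))⟩

lemma IsCylinder.hasLogDensity {B : Set ℕ+} {T : Finset B} {E : Set (H B)} (hE : IsCylinder T E) :
    HasLogDensity (diag B ⁻¹' E) ((haarH B).real E) := by
  rw [haarH_cylinder hE]
  exact hE.periodicSet.hasLogDensity (modulus_pos T)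

/-! ### The window -/

lemma diag_coord_eq_zero_iff {B : Set ℕ+} (n : ℤ) (b : B) :
    (diag B n : ProdGroup B) b = 0 ↔ (((b : ℕ+) : ℕ) : ℤ) ∣ n :=
  ZMod.intCast_zmod_eq_zero_iff_dvd n _

lemma diag_mem_window_iff {B : Set ℕ+} {n : ℤ} : diag B n ∈ window B ↔ n ∈ free B := by
  rw [mem_free]
  exact ⟨fun h b hb hbn => h ⟨b, hb⟩ ((diag_coord_eq_zero_iff n ⟨b, hb⟩).2 hbn),
    fun h b hbn => h b b.2 ((diag_coord_eq_zero_iff n b).1 hbn)⟩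

lemma isClosed_window (B : Set ℕ+) : IsClosed (window B) := by
  have : window B = ⋂ b : B, {h : H B | (h : ProdGroup B) b ≠ 0} := by
    ext h
    simp [window]
  rw [this]
  exact isClosed_iInter fun b =>
    (isClosed_discrete {(0 : ZMod (b : ℕ+))}ᶜ).preimage (continuous_coord B b)

/-- The neighbourhood of `Δ(n)` given by the coordinates in `S`. -/
def cylinder {B : Set ℕ+} (S : Finset B) (n : ℤ) : Set (H B) := {h | h - diag B n ∈ vanishing S}

lemma isCylinder_cylinder {B : Set ℕ+} (S : Finset B) (n : ℤ) : IsCylinder S (cylinder S n) :=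
  fun h h' hh hh' => by
    have := add_mem hh hh'
    rwa [sub_add_sub_cancel] at this

lemma diag_preimage_cylinder {B : Set ℕ+} (S : Finset B) (n : ℤ) :
    diag B ⁻¹' cylinder S n = progression n (modulus S) := by
  ext m
  exact diag_sub_mem_vanishing_iff S m n

lemma IsCylinder.mono {B : Set ℕ+} {S T : Finset B} {E : Set (H B)} (hE : IsCylinder S E)
    (h : S ⊆ T) : IsCylinder T E :=
  fun x y hxy hy => hE x y (fun b hb => hxy b (h hb)) hy

lemma IsCylinder.inter {B : Set ℕ+} {T : Finset B} {E F : Set (H B)} (hE : IsCylinder T E)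
    (hF : IsCylinder T F) : IsCylinder T (E ∩ F) :=
  fun x y hxy hy => ⟨hE x y hxy hy.1, hF x y hxy hy.2⟩

/-- The window for the truncation of `B` at `x`. -/
def truncWindow (B : Set ℕ+) (x : ℕ) : Set (H B) :=
  {h | ∀ b : B, ((b : ℕ+) : ℕ) ≤ x → (h : ProdGroup B) b ≠ 0}

lemma exists_isCylinder_truncWindow (B : Set ℕ+) (x : ℕ) :
    ∃ T : Finset B, IsCylinder T (truncWindow B x) := by
  have hfin : {b : B | ((b : ℕ+) : ℕ) ≤ x}.Finite := by
    refine Set.Finite.of_finite_image ((trunc_finite B x).subset ?_) Subtype.val_injective.injOn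
    rintro _ ⟨b, hb, rfl⟩
    exact ⟨b.2, hb⟩
  refine ⟨hfin.toFinset, fun h h' hh hh' b hb h0 => hh' b hb ?_⟩
  have h1 := hh b (hfin.mem_toFinset.2 hb)
  rw [AddSubgroup.coe_sub, Pi.sub_apply, h0, zero_sub, neg_eq_zero] at h1
  exact h1

lemma diag_preimage_truncWindow (B : Set ℕ+) (x : ℕ) :
    diag B ⁻¹' truncWindow B x = free (trunc B x) := by
  ext n
  rw [mem_free]
  exact ⟨fun h b hb hbn => h ⟨b, hb.1⟩ hb.2 ((diag_coord_eq_zero_iff n ⟨b, hb.1⟩).2 hbn),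
    fun h b hb hbn => h b ⟨b.2, hb⟩ ((diag_coord_eq_zero_iff n b).1 hbn)⟩

/-- A cylinder meets the window in a Haar null set if and only if the corresponding progression
meets the `B`-free integers in a set of logarithmic density zero. -/
lemma haarH_cylinder_inter_window_eq_zero_iff {B : Set ℕ+} (S : Finset B) (n : ℤ) :
    haarH B (cylinder S n ∩ window B) = 0 ↔ Null (progression n (modulus S) ∩ free B) := by
  classical
  have hcyl : ∀ x, ∃ T : Finset B, IsCylinder T (cylinder S n ∩ truncWindow B x) := fun x => by
    obtain ⟨T, hT⟩ := exists_isCylinder_truncWindow B x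
    exact ⟨S ∪ T, ((isCylinder_cylinder S n).mono Finset.subset_union_left).inter
      (hT.mono Finset.subset_union_right)⟩
  have hp : ∀ x, HasLogDensity (progression n (modulus S) ∩ free (trunc B x))
      ((haarH B).real (cylinder S n ∩ truncWindow B x)) := fun x => by
    obtain ⟨T, hT⟩ := hcyl x
    rw [← diag_preimage_cylinder, ← diag_preimage_truncWindow, ← Set.preimage_inter]
    exact hT.hasLogDensity
  rw [null_inter_free_iff hp]
  have hinter : ⋂ x, cylinder S n ∩ truncWindow B x = cylinder S n ∩ window B := by
    ext h
    simp only [Set.mem_iInter, Set.mem_inter_iff]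
    exact ⟨fun hh => ⟨(hh 0).1, fun b => (hh (b : ℕ+)).2 b le_rfl⟩,
      fun hh x => ⟨hh.1, fun b _ => hh.2 b⟩⟩
  have hanti : Antitone fun x => cylinder S n ∩ truncWindow B x := fun x y hxy =>
    Set.inter_subset_inter_right _ fun h hh b hb => hh b (hb.trans hxy)
  -- Continuity of the measure from above along the truncated windows. Zero limit here is the same
  -- condition as the one supplied by `null_inter_free_iff`.
  have hlim := tendsto_measure_iInter_atTop (μ := haarH B) (fun x => by
    obtain ⟨T, hT⟩ := hcyl x
    exact hT.isOpen.measurableSet.nullMeasurableSet) hanti ⟨0, measure_ne_top _ _⟩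
  rw [hinter] at hlim
  have hlim' := (ENNReal.tendsto_toReal (measure_ne_top _ _)).comp hlim
  constructor
  · intro h0
    rw [h0] at hlim'
    exact hlim'
  · intro h0
    exact (measureReal_eq_zero_iff).1 (tendsto_nhds_unique hlim' h0)

lemma mem_nhds_iff_exists_cylinder {B : Set ℕ+} {h : H B} {U : Set (H B)} (hU : U ∈ 𝓝 h) :
    ∃ S : Finset B, ∀ T, S ⊆ T → ∀ n : ℤ, h ∈ cylinder T n → cylinder T n ⊆ U := by
  obtain ⟨V, hV, hVU⟩ := mem_nhds_subtype _ _ _ |>.1 hU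
  obtain ⟨V', hV'V, hV'o, hV'h⟩ := mem_nhds_iff.1 hV
  obtain ⟨S, u, hu, huV⟩ := isOpen_pi_iff.1 hV'o _ hV'h
  refine ⟨S, fun T hST n hn h' hh' => hVU (hV'V (huV fun b hb => ?_))⟩
  have h1 := hn b (hST hb)
  have h2 := hh' b (hST hb)
  rw [AddSubgroup.coe_sub, Pi.sub_apply, sub_eq_zero] at h1 h2
  rw [h2, ← h1]
  exact (hu b hb).2

lemma exists_mem_cylinder {B : Set ℕ+} (S : Finset B) (h : H B) : ∃ n : ℤ, h ∈ cylinder S n := by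
  obtain ⟨n, -, hn⟩ := exists_sub_diag_mem_vanishing S h
  exact ⟨n, hn⟩

/-- Cylinders form a base of the topology and the window is closed, so the support can be tested on
cylinders, where measure zero is an arithmetic condition. -/
lemma haarRegular_iff {B : Set ℕ+} : HaarRegular B ↔ ∀ h ∈ window B, ∀ (S : Finset B) (n : ℤ),
    h ∈ cylinder S n → ¬ Null (progression n (modulus S) ∩ free B) := by
  have hW := (isClosed_window B).measurableSet
  constructor
  · intro hreg h hh S n hn hnull
    rw [← haarH_cylinder_inter_window_eq_zero_iff] at hnull
    have h1 : h ∈ ((haarH B).restrict (window B)).support := by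
      rw [HaarRegular] at hreg
      rwa [hreg]
    have h2 := (Measure.mem_support_iff_forall h).1 h1 _
      ((isCylinder_cylinder S n).isOpen.mem_nhds hn)
    rw [Measure.restrict_apply (isCylinder_cylinder S n).isOpen.measurableSet, hnull] at h2
    exact lt_irrefl _ h2
  · intro hall
    refine Set.Subset.antisymm
      (Measure.support_subset_of_isClosed (isClosed_window B) (ae_restrict_mem hW)) fun h hh => ?_
    refine (Measure.mem_support_iff_forall h).2 fun U hU => ?_
    obtain ⟨S, hS⟩ := mem_nhds_iff_exists_cylinder hU
    obtain ⟨n, hn⟩ := exists_mem_cylinder S h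
    refine lt_of_lt_of_le ?_ (measure_mono (hS S subset_rfl n hn))
    rw [Measure.restrict_apply (isCylinder_cylinder S n).isOpen.measurableSet, pos_iff_ne_zero,
      Ne, haarH_cylinder_inter_window_eq_zero_iff]
    exact hall h hh S n hn

lemma Taut.haarRegular {B : Set ℕ+} (hB : Taut B) : HaarRegular B := by
  classical
  refine haarRegular_iff.2 fun h hh S n hn => ?_
  -- `S` is enlarged to all elements of `B` dividing its least common multiple. Every `b` dividing
  -- the new modulus is then itself a coordinate of the cylinder, so `h_b ≠ 0` yields `b ∤ m`, as
  -- the arithmetic criterion requires.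
  have hfin : {b : B | ((b : ℕ+) : ℕ) ∣ modulus S}.Finite := by
    refine Set.Finite.of_finite_image ((trunc_finite B (modulus S)).subset ?_)
      Subtype.val_injective.injOn
    rintro _ ⟨b, hb, rfl⟩
    exact ⟨b.2, Nat.le_of_dvd (modulus_pos S) hb⟩
  have hmod : ∀ b ∈ B, (b : ℕ) ∣ modulus hfin.toFinset → (b : ℕ) ∣ modulus S := fun b _ hb =>
    hb.trans (Finset.lcm_dvd fun c hc => hfin.mem_toFinset.1 hc)
  obtain ⟨m, hm⟩ := exists_mem_cylinder hfin.toFinset h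
  have hnot := hB.not_null_progression (n := m) (modulus_pos hfin.toFinset) fun b hb hbl hbm => by
    have h1 := hm ⟨b, hb⟩ (hfin.mem_toFinset.2 (hmod b hb hbl))
    rw [AddSubgroup.coe_sub, Pi.sub_apply, (diag_coord_eq_zero_iff m ⟨b, hb⟩).2 hbm,
      sub_zero] at h1
    exact hh _ h1
  refine fun hnull => hnot (hnull.mono (Set.inter_subset_inter_left _ ?_))
  have hSsub : S ⊆ hfin.toFinset := fun b hb =>
    hfin.mem_toFinset.2 (Finset.dvd_lcm (f := fun b : B => ((b : ℕ+) : ℕ)) hb)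
  rw [← diag_preimage_cylinder, ← diag_preimage_cylinder]
  intro k hk b hb
  have h1 := hk b (hSsub hb)
  have h2 := hm b (hSsub hb)
  have h3 := hn b hb
  rw [AddSubgroup.coe_sub, Pi.sub_apply, sub_eq_zero] at h1 h2 h3 ⊢
  rw [h1, ← h2, h3]

/-- Without tautness some almost covered progression `n + b ℤ` contains a free `n`; the cylinder on
the single coordinate `b` around the window point `Δ(n)` then contradicts regularity. -/
lemma HaarRegular.taut {B : Set ℕ+} (hprim : Primitive B) (hB : HaarRegular B) : Taut B := by
  by_contra hT
  obtain ⟨n, hn, b, hb, hnull⟩ := hprim.exists_null_progression_of_not_taut hT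
  refine haarRegular_iff.1 hB _ (diag_mem_window_iff.2 hn) {⟨b, hb⟩} n ?_ ?_
  · simp [cylinder]
  · simpa [modulus] using hnull

lemma HaarRegular.closure_eq {B : Set ℕ+} (hB : HaarRegular B) :
    closure (Set.range (diag B) ∩ window B) = window B := by
  refine Set.Subset.antisymm
    (closure_minimal Set.inter_subset_right (isClosed_window B)) fun h hh => ?_
  refine mem_closure_iff_nhds.2 fun U hU => ?_
  obtain ⟨S, hS⟩ := mem_nhds_iff_exists_cylinder hU
  obtain ⟨n, hn⟩ := exists_mem_cylinder S h
  have hnot := haarRegular_iff.1 hB h hh S n hn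
  have hne : (progression n (modulus S) ∩ free B).Nonempty := by
    by_contra hempty
    rw [Set.not_nonempty_iff_eq_empty] at hempty
    refine hnot ?_
    rw [hempty, ← Set.compl_univ]
    have := hasLogDensity_univ.compl
    rwa [sub_self] at this
  obtain ⟨m, hm, hmB⟩ := hne
  rw [← diag_preimage_cylinder] at hm
  exact ⟨diag B m, hS S subset_rfl n hn hm, ⟨m, rfl⟩, diag_mem_window_iff.2 hmB⟩

end BFree

theorem theorem1p1 (B : Set ℕ+) (hne : B.Nonempty) (hprim : BFree.Primitive B) :
    (BFree.Taut B ↔ BFree.HaarRegular B) ∧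
      ((BFree.Taut B ∨ BFree.HaarRegular B) →
        closure (Set.range (BFree.diag B) ∩ BFree.window B) = BFree.window B) :=
  ⟨⟨fun h => h.haarRegular, fun h => h.taut hprim⟩,
    fun h => h.elim (fun h => h.haarRegular.closure_eq) fun h => h.closure_eq⟩
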